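/- A measure preserving system $(X,\mu,T)$ is a probability space $(X,\mu)$ together with an invertible $\mu$-measure preserving transformation $T:X\to X$. A set $S\subseteq\mathbb Z$ is a *set of recurrence* if for every measure preserving system $(X,\mu,T)$ and every measurable $D\subseteq X$ with $\mu(D)>0$ there is $n\in S$ with $\mu(D\cap T^{n}D)>0$; it is *measure expanding* if for every $m\in\mathbb Z$ the translate $S+m=\{s+m:s\in S\}$ is a set of recurrence. Write $\mathbb T=\mathbb R/\mathbb Z$, $\mathcal S^1=\{z\in\mathbb C:|z|=1\}$ and $e_n(x)=\exp(2\pi i n x)$ for $n\in\mathbb Z$, $x\in\mathbb T$. If $\mathcal P$ is a collection of subsets of $\mathbb Z$, a Borel probability measure $\sigma$ on $\mathbb T$ is a *KS-$(S,\mathcal P)$ measure* if for every $\varepsilon>0$ and every Borel measurable $f:\mathbb T\to\mathcal S^1$, $$\{n\in S:\ \|f-e_n\|_{L^1(\sigma)}<\varepsilon\}\in\mathcal P .$$ **Lemma 7.4.** Let $\mathcal R^{\bullet}$ be the collection of measure expanding subsets of $\mathbb Z$. If $S\subseteq\mathbb Z$ is measure expanding, then there is a KS-$(S,\mathcal R^{\bullet})$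 probability measure $\sigma$ on $\mathbb T$ which is continuous, i.e. $\sigma(\{a\})=0$ for every $a\in\mathbb T$. That is, for every Borel $f:\mathbb T\to\mathcal S^1$ and every $\varepsilon>0$, the set $\{n\in S:\|f-e_n\|_{L^1(\sigma)}<\varepsilon\}$ is measure expanding. -/

import Mathlib

open MeasureTheory

/-- `S ⊆ ℤ` is a set of recurrence: for every invertible probability measure preserving system
`(X, μ, T)` and every measurable `D ⊆ X` with `μ D > 0` there is `n ∈ S` with `μ (D ∩ Tⁿ D) > 0`.
Systems on types in universe `0` suffice, see `IsSetOfRecurrence.exists_pos`. -/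
def IsSetOfRecurrence (S : Set ℤ) : Prop :=
  ∀ (X : Type) [MeasurableSpace X] (μ : Measure X) [IsProbabilityMeasure μ] (T : X ≃ᵐ X),
    MeasurePreserving T μ μ → ∀ D : Set X, MeasurableSet D → 0 < μ D →
      ∃ n ∈ S, 0 < μ (D ∩ (T.toEquiv ^ n : Equiv.Perm X) '' D)

/-- `S ⊆ ℤ` is measure expanding: every translate `S + m` is a set of recurrence. -/
def IsMeasureExpanding (S : Set ℤ) : Prop :=
  ∀ m : ℤ, IsSetOfRecurrence ((fun s : ℤ => s + m) '' S)

/-- A Borel measure `σ` on `𝕋 = ℝ / ℤ` is a KS-`(S, P)` measure: it is a probability measure and,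
for all `ε > 0` and all Borel `f : 𝕋 → S¹`, the set `{n ∈ S : ‖f - eₙ‖_{L¹(σ)} < ε}` belongs to
`P`.  The circle `S¹` is the set of complex numbers of modulus `1`, and `eₙ x = exp (2πinx)` is `fourier n`. -/
structure IsKSMeasure (S : Set ℤ) (P : Set (Set ℤ)) (σ : Measure UnitAddCircle) : Prop where
  isProbabilityMeasure : IsProbabilityMeasure σ
  mem : ∀ ε : ℝ, 0 < ε → ∀ f : UnitAddCircle → ℂ, Measurable f → (∀ x, ‖f x‖ = 1) →
    {n : ℤ | n ∈ S ∧
      eLpNorm (fun x => f x - fourier n x) 1 σ < ENNReal.ofReal ε} ∈ P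

/-- The integer shift on two-sided binary sequences, as a measurable equivalence. -/
def binaryShift : (ℤ → Bool) ≃ᵐ (ℤ → Bool) where
  toFun w k := w (k + 1)
  invFun w k := w (k - 1)
  left_inv w := by funext k; simp
  right_inv w := by funext k; simp
  measurable_toFun := by
    exact measurable_pi_lambda _ fun k => measurable_pi_apply (k + 1)
  measurable_invFun := by
    exact measurable_pi_lambda _ fun k => measurable_pi_apply (k - 1)

/-- A set of recurrence is recurrent for systems on types in every universe: code a system by the
itineraries of its points with respect to `D`. -/
theorem IsSetOfRecurrence.exists_pos.{u} {S : Set ℤ} (hS : IsSetOfRecurrence S)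
    (X : Type u) [MeasurableSpace X] (μ : Measure X) [IsProbabilityMeasure μ] (T : X ≃ᵐ X)
    (hT : MeasurePreserving T μ μ) (D : Set X) (hD : MeasurableSet D) (hpos : 0 < μ D) :
    ∃ n ∈ S, 0 < μ (D ∩ (T.toEquiv ^ n : Equiv.Perm X) '' D) := by
  classical
  have hmz : ∀ n : ℤ, Measurable (T.toEquiv ^ n : Equiv.Perm X) := by
    have h1 : ∀ k : ℕ, Measurable (T.toEquiv ^ k : Equiv.Perm X) := by
      intro k
      induction k with
      | zero => simpa using measurable_id
      | succ k ih => rw [pow_succ]; exact ih.comp T.measurable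
    have h2 : ∀ k : ℕ, Measurable ((T.toEquiv⁻¹ : Equiv.Perm X) ^ k : Equiv.Perm X) := by
      intro k
      induction k with
      | zero => simpa using measurable_id
      | succ k ih => rw [pow_succ]; exact ih.comp T.symm.measurable
    intro n
    obtain ⟨k, rfl | rfl⟩ := n.eq_nat_or_neg
    · simpa using h1 k
    · have := h2 k
      rwa [inv_pow, ← zpow_natCast, ← zpow_neg] at this
  let φ : X → ℤ → Bool := fun x k => decide ((T.toEquiv ^ k : Equiv.Perm X) x ∈ D)
  have hφ : Measurable φ := by
    refine measurable_pi_lambda _ fun k => ?_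
    refine measurable_to_bool ?_
    have : (fun x => φ x k) ⁻¹' {true} = (T.toEquiv ^ k : Equiv.Perm X) ⁻¹' D := by
      ext x; simp [φ]
    rw [this]
    exact hmz k hD
  have hcomm : ∀ x, φ (T x) = binaryShift (φ x) := by
    intro x
    funext k
    change decide ((T.toEquiv ^ k : Equiv.Perm X) (T.toEquiv x) ∈ D) =
      decide ((T.toEquiv ^ (k + 1) : Equiv.Perm X) x ∈ D)
    rw [zpow_add_one]; rfl
  have hshift : ∀ (n : ℤ) (w : ℤ → Bool),
      (binaryShift.toEquiv ^ n : Equiv.Perm (ℤ → Bool)) w = fun k => w (k + n) := by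
    have h1 : ∀ (k : ℕ) (w : ℤ → Bool),
        (binaryShift.toEquiv ^ k : Equiv.Perm (ℤ → Bool)) w = fun j => w (j + k) := by
      intro k
      induction k with
      | zero => intro w; simp
      | succ k ih =>
        intro w
        rw [pow_succ, Equiv.Perm.mul_apply, ih]
        funext j
        change w (j + k + 1) = _
        congr 1; push_cast; ring
    intro n w
    obtain ⟨k, rfl | rfl⟩ := n.eq_nat_or_neg
    · simpa using h1 k w
    · rw [zpow_neg, zpow_natCast, Equiv.Perm.inv_eq_iff_eq, h1]
      funext j; simp
  let ν := μ.map φ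
  have : IsProbabilityMeasure ν := Measure.isProbabilityMeasure_map hφ.aemeasurable
  have hν : MeasurePreserving binaryShift ν ν := by
    refine ⟨binaryShift.measurable, ?_⟩
    rw [Measure.map_map binaryShift.measurable hφ]
    have : binaryShift ∘ φ = φ ∘ T := by funext x; exact (hcomm x).symm
    rw [this, ← Measure.map_map hφ T.measurable, hT.map_eq]
  let C : Set (ℤ → Bool) := {w | w 0 = true}
  have hC : MeasurableSet C := 
    measurableSet_eq_fun (measurable_pi_apply (0 : ℤ)) measurable_const
  have hpre : φ ⁻¹' C = D := by ext x; simp [φ, C]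
  obtain ⟨n, hn, h⟩ := hS (ℤ → Bool) ν binaryShift hν C hC (by
    rw [Measure.map_apply hφ hC, hpre]; exact hpos)
  refine ⟨n, hn, ?_⟩
  have hset : C ∩ (binaryShift.toEquiv ^ n : Equiv.Perm (ℤ → Bool)) '' C =
      C ∩ {w | w (-n) = true} := by
    congr 1
    ext w
    rw [Equiv.image_eq_preimage_symm]
    change (binaryShift.toEquiv ^ n : Equiv.Perm (ℤ → Bool))⁻¹ w ∈ C ↔ _
    rw [← zpow_neg, hshift]
    simp [C]
  have hset' : MeasurableSet (C ∩ {w : ℤ → Bool | w (-n) = true}) :=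
    hC.inter (measurableSet_eq_fun (measurable_pi_apply (-n)) measurable_const)
  rw [hset, Measure.map_apply hφ hset', Set.preimage_inter, hpre] at h
  convert h using 3
  rw [Equiv.image_eq_preimage_symm]
  ext x
  change (T.toEquiv ^ n : Equiv.Perm X)⁻¹ x ∈ D ↔ _
  rw [← zpow_neg]
  simp [φ]

/-!
A finite step and a limit produce the measure.

*Finite step.* Let `x₁, …, xₙ` be points of the circle and `z₁, …, zₙ` unimodular numbers. The
characters `e_s` with `s ∈ S` can be brought close to `z_j` at `x_j` for all but a small proportion
of the `j`, with `s` a return time for a given set `D` of measure `δ`, once `n` is large and the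
points have been moved slightly. Indeed, move them to fractions with distinct large prime
denominators. It then suffices to prescribe the residue of `s` modulo most of these primes, which by
the Chinese remainder theorem amounts to a Hamming ball in a product of cyclic groups. Two dense
sets in a product of `n` finite sets are at Hamming distance `O(√n)` (`exists_hammingDist_le`),
which makes some `k` in the ball a return time for `D` (`exists_mem_real_pos_of_forall_finset`). As
the translate `S - k` is a set of recurrence, the set of points returning at time `k` returns to
itself at some `s - k` with `s ∈ S` that is a multiple of all the primes; such an `s` is a return
time for `D` with the residues of `k` (`IsMeasureExpanding.isRecurrentAt_modEq`). By compactness of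
the space of shift-invariant measures finitely many `s` serve all systems and all `D` of measure `δ`
(`IsRecurrentAt.exists_finset`).

*Limit.* Iterate the finite step, splitting every point into sixteen at each stage, with tolerance
and `δ` tending to `0`, and moving points so little that the finitely many characters chosen before
hardly change. The resulting sequence of step functions on `[0, 1)` converges to a function `Φ`, and
the measure is the distribution of `Φ`. A Borel function of `Φ` is close in `L¹` to step functions
of fine scale, hence to the characters chosen at a late stage
(`IsMeasureExpanding.exists_isKSMeasure`). Continuity needs no care in the construction: the
characters of a set of recurrence cannot all be close to `-1` at an atom
(`IsKSMeasure.measure_singleton_eq_zero`).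
-/

/-! ### Recurrence at a fixed density -/

/-- `W` is recurrent at density `δ`: every shift-invariant probability measure on binary sequences
for which the letter at `0` is `true` with probability at least `δ` gives positive probability to
`true` at both `0` and `n`, for some `n ∈ W`.  By coding orbits through itineraries this is
recurrence for all sets of measure at least `δ` in all systems. -/
def IsRecurrentAt (δ : ℝ) (W : Set ℤ) : Prop :=
  ∀ ν : Measure (ℤ → Bool), IsProbabilityMeasure ν → MeasurePreserving binaryShift ν ν →
    δ ≤ ν.real {w | w 0 = true} → ∃ n ∈ W, 0 < ν.real {w | w 0 = true ∧ w n = true}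

theorem IsRecurrentAt.mono {δ δ' : ℝ} {W W' : Set ℤ} (h : IsRecurrentAt δ W) (hδ : δ ≤ δ')
    (hW : W ⊆ W') : IsRecurrentAt δ' W' := by
  intro ν h1 h2 h3
  obtain ⟨n, hn, hpos⟩ := h ν h1 h2 (hδ.trans h3)
  exact ⟨n, hW hn, hpos⟩

theorem MeasureTheory.MeasurePreserving.perm_zpow {X : Type*} [MeasurableSpace X] {μ : Measure X}
    {T : X ≃ᵐ X} (hT : MeasurePreserving T μ μ) (n : ℤ) :
    MeasurePreserving (T.toEquiv ^ n : Equiv.Perm X) μ μ := by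
  induction n with
  | zero => simpa using MeasurePreserving.id μ
  | succ n ih =>
    rw [zpow_add_one]
    exact ih.comp hT
  | pred n ih =>
    rw [zpow_sub_one]
    exact ih.comp (MeasurePreserving.symm T hT)

theorem Equiv.Perm.zpow_apply_of_semiconj {X Y : Type*} {φ : X → Y} {T : Equiv.Perm X}
    {U : Equiv.Perm Y} (h : ∀ x, φ (T x) = U (φ x)) (n : ℤ) (x : X) :
    φ ((T ^ n) x) = (U ^ n) (φ x) := by
  induction n generalizing x with
  | zero => simp
  | succ n ih => rw [zpow_add_one, zpow_add_one, mul_apply, mul_apply, ih, h]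
  | pred n ih =>
    rw [zpow_sub_one, zpow_sub_one, mul_apply, mul_apply, ih]
    congr 1
    rw [Equiv.Perm.eq_inv_iff_eq, ← h]
    simp

theorem addRight_zpow {G : Type*} [AddGroup G] [MeasurableSpace G] [MeasurableAdd G] (a : G)
    (n : ℤ) (x : G) :
    ((MeasurableEquiv.addRight a).toEquiv ^ n : Equiv.Perm G) x = x + n • a := by
  induction n generalizing x with
  | zero => simp
  | succ n ih =>
    rw [zpow_add_one, Equiv.Perm.mul_apply, ih, add_comm (n : ℤ), add_zsmul, one_zsmul,
      ← add_assoc]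
    rfl
  | pred n ih =>
    rw [zpow_sub_one, Equiv.Perm.mul_apply, ih, sub_eq_add_neg, add_comm (-(n : ℤ)), add_zsmul,
      neg_one_zsmul, ← add_assoc]
    rfl

theorem binaryShift_zpow (n : ℤ) (w : ℤ → Bool) (k : ℤ) :
    (binaryShift.toEquiv ^ n : Equiv.Perm (ℤ → Bool)) w k = w (k + n) := by
  induction n generalizing w with
  | zero => simp
  | succ n ih =>
    rw [zpow_add_one, Equiv.Perm.mul_apply, ih]
    change w (k + n + 1) = _
    rw [add_assoc]
  | pred n ih =>
    rw [zpow_sub_one, Equiv.Perm.mul_apply, ih]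
    change w (k + -n - 1) = _
    congr 1; ring

theorem measurableSet_apply_eq_true (n : ℤ) : MeasurableSet {w : ℤ → Bool | w n = true} :=
  measurableSet_eq_fun (measurable_pi_apply n) measurable_const

theorem isClopen_apply_eq_true (n : ℤ) : IsClopen {w : ℤ → Bool | w n = true} :=
  (isClopen_discrete ({true} : Set Bool)).preimage (continuous_apply n)

/-- Stationarity of a shift-invariant measure: only the difference of two positions matters. -/
theorem real_apply_and_apply {ν : Measure (ℤ → Bool)} (hν : MeasurePreserving binaryShift ν ν)
    (a b : ℤ) : ν.real {w | w a = true ∧ w b = true} =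
      ν.real {w | w 0 = true ∧ w (b - a) = true} := by
  have hm : MeasurableSet {w : ℤ → Bool | w 0 = true ∧ w (b - a) = true} :=
    (measurableSet_apply_eq_true 0).inter (measurableSet_apply_eq_true (b - a))
  rw [measureReal_def, measureReal_def,
    ← (hν.perm_zpow a).measure_preimage hm.nullMeasurableSet]
  congr 2
  ext w
  simp [binaryShift_zpow]

theorem real_apply {ν : Measure (ℤ → Bool)} (hν : MeasurePreserving binaryShift ν ν)
    (a : ℤ) : ν.real {w | w a = true} = ν.real {w | w 0 = true} := by
  simpa using real_apply_and_apply hν a a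

/-- Recurrence at every density is recurrence: replace a system by the distribution of the
itineraries of its points. -/
theorem isSetOfRecurrence_of_forall_isRecurrentAt {W : Set ℤ}
    (h : ∀ δ : ℝ, 0 < δ → IsRecurrentAt δ W) : IsSetOfRecurrence W := by
  classical
  intro X _ μ _ T hT D hD hpos
  have hmz (n : ℤ) : Measurable (T.toEquiv ^ n : Equiv.Perm X) := (hT.perm_zpow n).measurable
  let φ : X → ℤ → Bool := fun x k => decide ((T.toEquiv ^ k : Equiv.Perm X) x ∈ D)
  have hφ : Measurable φ := by
    refine measurable_pi_lambda _ fun k => measurable_to_bool ?_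
    have : (fun x => φ x k) ⁻¹' {true} = (T.toEquiv ^ k : Equiv.Perm X) ⁻¹' D := by
      ext x; simp [φ]
    rw [this]
    exact hmz k hD
  have hcomm : ∀ x, φ (T x) = binaryShift (φ x) := by
    intro x
    funext k
    change decide ((T.toEquiv ^ k : Equiv.Perm X) (T.toEquiv x) ∈ D) =
      decide ((T.toEquiv ^ (k + 1) : Equiv.Perm X) x ∈ D)
    rw [zpow_add_one]; rfl
  have hν : MeasurePreserving binaryShift (μ.map φ) (μ.map φ) := by
    refine ⟨binaryShift.measurable, ?_⟩
    rw [Measure.map_map binaryShift.measurable hφ]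
    have : binaryShift ∘ φ = φ ∘ T := by funext x; exact (hcomm x).symm
    rw [this, ← Measure.map_map hφ T.measurable, hT.map_eq]
  have hpre (n : ℤ) : φ ⁻¹' {w | w n = true} = (T.toEquiv ^ n : Equiv.Perm X) ⁻¹' D := by
    ext x; simp [φ]
  obtain ⟨n, hn, hn'⟩ := h (μ.real D) (by simp [measureReal_def, ENNReal.toReal_pos_iff, hpos])
    (μ.map φ) (Measure.isProbabilityMeasure_map hφ.aemeasurable) hν (by
      rw [map_measureReal_apply hφ (measurableSet_apply_eq_true 0), hpre]
      simp)
  refine ⟨n, hn, ?_⟩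
  have hm : MeasurableSet ({w : ℤ → Bool | w 0 = true} ∩ {w | w n = true}) :=
    (measurableSet_apply_eq_true 0).inter (measurableSet_apply_eq_true n)
  rw [measureReal_def, ENNReal.toReal_pos_iff, Set.ofPred_and, Measure.map_apply hφ hm,
    Set.preimage_inter, hpre, hpre] at hn'
  have hinv := (hT.perm_zpow (-n)).measure_preimage
    (s := D ∩ (T.toEquiv ^ n : Equiv.Perm X) ⁻¹' D) (hD.inter (hmz n hD)).nullMeasurableSet
  -- The letters at `0` and `n` code `D ∩ T⁻ⁿ D`, whose image under `Tⁿ` is `D ∩ Tⁿ D`.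
  have hset : (T.toEquiv ^ (-n) : Equiv.Perm X) ⁻¹' (D ∩ (T.toEquiv ^ n : Equiv.Perm X) ⁻¹' D) =
      D ∩ (T.toEquiv ^ n : Equiv.Perm X) '' D := by
    rw [Equiv.image_eq_preimage_symm]
    ext x
    have : (T.toEquiv ^ n : Equiv.Perm X).symm x = (T.toEquiv ^ (-n) : Equiv.Perm X) x := by
      rw [zpow_neg]; rfl
    simp only [Set.mem_preimage, Set.mem_inter_iff, this]
    rw [← Equiv.Perm.mul_apply, ← zpow_add]
    simp [and_comm]
  rw [← hset, hinv]
  simpa using hn'.1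

/-- Every set of recurrence contains a finite set recurrent at a prescribed density: the
shift-invariant measures in question form a compact space, covered by the open conditions
`0 < ν {w | w 0 = true ∧ w n = true}`. -/
theorem IsRecurrentAt.exists_finset {δ : ℝ} {S : Set ℤ} (hS : IsRecurrentAt δ S) :
    ∃ W : Finset ℤ, (W : Set ℤ) ⊆ S ∧ IsRecurrentAt δ (W : Set ℤ) := by
  have hsh : Continuous binaryShift :=
    continuous_pi fun k => continuous_apply (k + 1)
  have hcont {C : Set (ℤ → Bool)} (hC : IsClopen C) :
      Continuous fun ν : ProbabilityMeasure (ℤ → Bool) => ν C := by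
    refine continuous_iff_continuousAt.2 fun ν => ?_
    refine ProbabilityMeasure.tendsto_measure_of_null_frontier_of_tendsto Filter.tendsto_id ?_
    rw [hC.frontier_eq]
    simp
  let K : Set (ProbabilityMeasure (ℤ → Bool)) :=
    {ν | ν.map hsh.measurable.aemeasurable = ν} ∩ {ν | δ ≤ (ν {w | w 0 = true} : ℝ)}
  have hK : IsCompact K := by
    refine IsClosed.isCompact (IsClosed.inter ?_ ?_)
    · exact isClosed_eq (ProbabilityMeasure.continuous_map hsh) continuous_id
    · exact isClosed_le continuous_const
        (NNReal.continuous_coe.comp (hcont (isClopen_apply_eq_true 0)))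
  have hpres {ν : ProbabilityMeasure (ℤ → Bool)} :
      ν.map hsh.measurable.aemeasurable = ν ↔ MeasurePreserving binaryShift (ν : Measure _) ν := by
    constructor
    · intro h
      exact ⟨hsh.measurable, by simpa using congrArg ProbabilityMeasure.toMeasure h⟩
    · intro h
      exact Subtype.ext h.map_eq
  have hopen (n : ℤ) : IsOpen {ν : ProbabilityMeasure (ℤ → Bool) |
      0 < (ν {w | w 0 = true ∧ w n = true} : ℝ)} :=
    isOpen_lt continuous_const (NNReal.continuous_coe.comp
      (hcont ((isClopen_apply_eq_true 0).inter (isClopen_apply_eq_true n))))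
  obtain ⟨t, ht, hcov⟩ := hK.elim_finite_subcover_image (b := S)
    (fun n _ => hopen n)
    (by
      rintro ν ⟨h1, h2⟩
      obtain ⟨n, hn, hpos⟩ := hS ν inferInstance (hpres.1 h1) h2
      exact Set.mem_biUnion hn hpos)
  obtain ⟨hfin, hcov⟩ := hcov
  refine ⟨hfin.toFinset, by simpa using ht, ?_⟩
  intro ν hν hinv hδ
  obtain ⟨n, hn, hpos⟩ := Set.mem_iUnion₂.1
    (hcov (show (⟨ν, hν⟩ : ProbabilityMeasure (ℤ → Bool)) ∈ K from ⟨hpres.2 hinv, hδ⟩))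
  exact ⟨n, by simpa using hn, hpos⟩

/-! ### Prescribing residues of return times -/

/-- Return times to a positive set along a set of recurrence can be taken divisible by `Q`, as
seen from the product with the rotation of `ZMod Q`. -/
theorem IsSetOfRecurrence.exists_dvd {S : Set ℤ} (hS : IsSetOfRecurrence S) {Q : ℕ} [NeZero Q]
    {X : Type} [MeasurableSpace X] {μ : Measure X} [IsProbabilityMeasure μ] {T : X ≃ᵐ X}
    (hT : MeasurePreserving T μ μ) {D : Set X} (hD : MeasurableSet D) (hpos : 0 < μ D) :
    ∃ n ∈ S, (Q : ℤ) ∣ n ∧ 0 < μ (D ∩ (T.toEquiv ^ n : Equiv.Perm X) '' D) := by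
  let κ : Measure (ZMod Q) := (Q : ENNReal)⁻¹ • Measure.count
  have : IsProbabilityMeasure κ := ⟨by
    simp [κ, Measure.count_apply, ENNReal.inv_mul_cancel, NeZero.ne]⟩
  let R : ZMod Q ≃ᵐ ZMod Q := MeasurableEquiv.addRight 1
  have hR : MeasurePreserving R κ κ := (measurePreserving_add_right Measure.count 1).smul_measure _
  have hRn (n : ℤ) (r : ZMod Q) : (R.toEquiv ^ n : Equiv.Perm (ZMod Q)) r = r + n :=
    (addRight_zpow (1 : ZMod Q) n r).trans (by rw [zsmul_one])
  have hDm : MeasurableSet (D ×ˢ ({0} : Set (ZMod Q))) := hD.prod (measurableSet_singleton 0)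
  let U : X × ZMod Q ≃ᵐ X × ZMod Q := T.prodCongr R
  have hU : MeasurePreserving U (μ.prod κ) (μ.prod κ) := hT.prod hR
  obtain ⟨n, hn, hn'⟩ := hS (X × ZMod Q) (μ.prod κ) U hU _ hDm (by
    rw [Measure.prod_prod]
    refine ENNReal.mul_pos hpos.ne' ?_
    simp [κ, ENNReal.inv_eq_zero])
  have hfst (p : X × ZMod Q) : ((U.toEquiv ^ n : Equiv.Perm _) p).1 =
      (T.toEquiv ^ n : Equiv.Perm X) p.1 :=
    Equiv.Perm.zpow_apply_of_semiconj (φ := Prod.fst) (fun _ => rfl) n p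
  have hsnd (p : X × ZMod Q) : ((U.toEquiv ^ n : Equiv.Perm _) p).2 = p.2 + n := by
    rw [← hRn]
    exact Equiv.Perm.zpow_apply_of_semiconj (φ := Prod.snd) (fun _ => rfl) n p
  refine ⟨n, hn, ?_, ?_⟩
  · obtain ⟨_, ⟨-, h0⟩, p, ⟨-, hp⟩, rfl⟩ := nonempty_of_measure_ne_zero hn'.ne'
    rw [Set.mem_singleton_iff] at h0 hp
    rw [hsnd, hp, zero_add] at h0
    exact (ZMod.intCast_zmod_eq_zero_iff_dvd n Q).1 h0
  · refine hn'.trans_le ?_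
    calc _ ≤ μ.prod κ ((D ∩ (T.toEquiv ^ n : Equiv.Perm X) '' D) ×ˢ Set.univ) := by
          refine measure_mono ?_
          rintro _ ⟨⟨h1, -⟩, p, ⟨hp, -⟩, rfl⟩
          exact ⟨⟨h1, p.1, hp, (hfst p).symm⟩, trivial⟩
      _ = _ := by rw [Measure.prod_prod, measure_univ, mul_one]

/-- In a stationary process with `true` of probability at least `δ`, the positions `a < Q` of the
letter `true` have density at least `δ / 2` in `{0, …, Q - 1}` with positive probability.  So a set
`K` meeting the differences of all sets of that density contains a return time. -/
theorem exists_mem_real_pos_of_forall_finset {δ : ℝ} (hδ : 0 < δ) {ν : Measure (ℤ → Bool)}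
    [IsProbabilityMeasure ν] (hν : MeasurePreserving binaryShift ν ν)
    (hd : δ ≤ ν.real {w | w 0 = true}) {Q : ℕ} (hQ : 0 < Q) {K : Set ℤ}
    (hK : ∀ A ⊆ Finset.range Q, δ / 2 * Q ≤ A.card → ∃ a ∈ A, ∃ b ∈ A, (a - b : ℤ) ∈ K) :
    ∃ k ∈ K, 0 < ν.real {w | w 0 = true ∧ w k = true} := by
  -- Otherwise almost every sequence has fewer than `δ / 2 * Q` letters `true` in `{0, …, Q - 1}`,
  -- although there are at least `δ * Q` of them on average.
  by_contra! hcon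
  have hnull (a b : ℕ) (hab : (a - b : ℤ) ∈ K) : ∀ᵐ w ∂ν, ¬ (w b = true ∧ w a = true) := by
    rw [ae_iff]
    have h := le_antisymm (hcon _ hab) measureReal_nonneg
    rw [← real_apply_and_apply hν, measureReal_eq_zero_iff] at h
    simpa using h
  have hae : ∀ᵐ w ∂ν, ∀ a b : ℕ, (a - b : ℤ) ∈ K → ¬ (w b = true ∧ w a = true) := by
    simp only [ae_all_iff]
    exact hnull
  have hint : ∫ w, ∑ a ∈ Finset.range Q,
      ({w : ℤ → Bool | w a = true}.indicator (fun _ => (1 : ℝ))) w ∂ν ≤ δ / 2 * Q := by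
    have : ∫ _ : ℤ → Bool, δ / 2 * Q ∂ν = δ / 2 * Q := by simp
    rw [← this]
    refine integral_mono_ae ?_ (integrable_const _) ?_
    · exact integrable_finsetSum _ fun a _ =>
        (integrable_const (1 : ℝ)).indicator (measurableSet_apply_eq_true a)
    · filter_upwards [hae] with w hw
      have hcard := mt (hK ((Finset.range Q).filter fun a => w a = true)
        (Finset.filter_subset _ _)) (by
          rintro ⟨a, ha, b, hb, hab⟩
          exact hw a b hab ⟨(Finset.mem_filter.1 hb).2, (Finset.mem_filter.1 ha).2⟩)
      rw [not_le, Finset.card_filter] at hcard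
      refine le_trans (le_of_eq ?_) hcard.le
      push_cast
      refine Finset.sum_congr rfl fun a _ => ?_
      simp [Set.indicator_apply]
  rw [integral_finsetSum _ fun (a : ℕ) _ =>
    (integrable_const (1 : ℝ)).indicator (measurableSet_apply_eq_true a)] at hint
  simp only [integral_indicator_const (1 : ℝ) (measurableSet_apply_eq_true _), real_apply hν,
    Finset.sum_const, Finset.card_range, nsmul_eq_mul, smul_eq_mul, mul_one]
    at hint
  have hQ' : (0 : ℝ) < Q := by exact_mod_cast hQ
  nlinarith

/-- If `S` is measure expanding, then return times to sets of measure `δ` in `S` can be found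
congruent modulo `Q` to an element of `K`, provided `K` meets the differences of all sets of density
`δ / 2` modulo `Q`.  First return along some `k ∈ K`, then apply recurrence of `S - k` to the
set of points returning at time `k`. -/
theorem IsMeasureExpanding.isRecurrentAt_modEq {S : Set ℤ} (hS : IsMeasureExpanding S) {δ : ℝ}
    (hδ : 0 < δ) {Q : ℕ} (hQ : 0 < Q) {K : Set ℤ}
    (hK : ∀ A ⊆ Finset.range Q, δ / 2 * Q ≤ A.card → ∃ a ∈ A, ∃ b ∈ A, (a - b : ℤ) ∈ K) :
    IsRecurrentAt δ {s | s ∈ S ∧ ∃ k ∈ K, s ≡ k [ZMOD Q]} := by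
  intro ν _ hν hd
  obtain ⟨k, hk, hpos⟩ := exists_mem_real_pos_of_forall_finset hδ hν hd hQ hK
  have : NeZero Q := ⟨hQ.ne'⟩
  have hC : MeasurableSet {w : ℤ → Bool | w 0 = true ∧ w k = true} :=
    (measurableSet_apply_eq_true 0).inter (measurableSet_apply_eq_true k)
  obtain ⟨t, ⟨s, hs, rfl⟩, hdvd, ht⟩ := (hS (-k)).exists_dvd (Q := Q) hν hC
    (ENNReal.toReal_pos_iff.1 hpos).1
  refine ⟨s, ⟨hs, k, hk, ?_⟩, ?_⟩
  · exact (Int.modEq_iff_dvd.2 (by simpa [sub_eq_add_neg] using hdvd)).symm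
  · rw [measureReal_def, ENNReal.toReal_pos_iff]
    refine ⟨?_, measure_lt_top _ _⟩
    have hsub : {w : ℤ → Bool | w 0 = true ∧ w k = true} ∩
        (binaryShift.toEquiv ^ (s + -k) : Equiv.Perm (ℤ → Bool)) ''
          {w : ℤ → Bool | w 0 = true ∧ w k = true} ⊆ {w | w (k - s) = true ∧ w k = true} := by
      rintro _ ⟨⟨h0, hk'⟩, w, ⟨hw0, hwk⟩, rfl⟩
      refine ⟨?_, hk'⟩
      rwa [binaryShift_zpow, show k - s + (s + -k) = 0 by ring]
    have h := ht.trans_le (measure_mono hsub)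
    have h' := real_apply_and_apply hν (k - s) k
    rw [sub_sub_cancel, measureReal_def, measureReal_def,
      ENNReal.toReal_eq_toReal_iff' (measure_ne_top _ _) (measure_ne_top _ _)] at h'
    rwa [h'] at h

/-! ### Concentration for the Hamming distance -/

theorem sum_sum_sub_sq {ι : Type*} [Fintype ι] (h : ι → ℝ) :
    ∑ i, ∑ j, (h i - h j) ^ 2 = 2 * (Fintype.card ι * ∑ i, h i ^ 2 - (∑ i, h i) ^ 2) := by
  simp only [sub_sq, Finset.sum_add_distrib, Finset.sum_sub_distrib, Finset.sum_const,
    Finset.card_univ, nsmul_eq_mul, ← Finset.mul_sum, ← Finset.sum_mul]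
  ring

theorem hammingDist_cons {n : ℕ} {α : Fin (n + 1) → Type*} [∀ i, DecidableEq (α i)] (a b : α 0)
    (x y : ∀ i : Fin n, α i.succ) :
    hammingDist (Fin.cons a x : ∀ i, α i) (Fin.cons b y) =
      (if a = b then 0 else 1) + hammingDist x y := by
  simp only [hammingDist, Fin.card_filter_univ_succ, Fin.cons_zero, Fin.cons_succ]
  by_cases h : a = b
  · simp [h]
  · simp [h, add_comm]

/-- The variance of a function that is `1`-Lipschitz for the Hamming distance on a product of `n`
finite sets is at most `n / 2`; here it is written as a sum over pairs of points. Induction on `n`: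
the variance splits into the mean of the conditional variances given the first coordinate and the
variance of the conditional means. -/
theorem sum_sum_sub_sq_le_of_hammingDist {n : ℕ} {α : Fin n → Type*} [∀ i, Fintype (α i)]
    [∀ i, DecidableEq (α i)] {f : (∀ i, α i) → ℝ} (hf : ∀ x y, |f x - f y| ≤ hammingDist x y) :
    ∑ x, ∑ y, (f x - f y) ^ 2 ≤ n * (Fintype.card (∀ i, α i) : ℝ) ^ 2 := by
  induction n with
  | zero => simp [Subsingleton.elim _ (default : ∀ i, α i)]
  | succ n ih =>
    let e := Fin.consEquiv α
    let g : α 0 → ℝ := fun a => ∑ x, f (Fin.cons a x)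
    set A : ℝ := (Fintype.card (α 0) : ℝ)
    set B : ℝ := (Fintype.card (∀ i : Fin n, α i.succ) : ℝ)
    have hcard : (Fintype.card (∀ i, α i) : ℝ) = A * B := by
      rw [← Fintype.card_congr e, Fintype.card_prod, Nat.cast_mul]
    have hsum (F : (∀ i, α i) → ℝ) : ∑ x, F x = ∑ a, ∑ x, F (Fin.cons a x) := by
      rw [← e.sum_comp, Fintype.sum_prod_type]
      rfl
    have hsplit : ∑ x, ∑ y, (f x - f y) ^ 2 =
        A * ∑ a, ∑ x, ∑ y, (f (Fin.cons a x) - f (Fin.cons a y)) ^ 2 +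
          ∑ a, ∑ b, (g a - g b) ^ 2 := by
      simp only [sum_sum_sub_sq, hcard, ← Finset.mul_sum, Finset.sum_sub_distrib]
      rw [hsum, hsum]
      ring
    have h1 (a : α 0) : ∑ x, ∑ y, (f (Fin.cons a x) - f (Fin.cons a y)) ^ 2 ≤ n * B ^ 2 :=
      ih fun x y => (hf _ _).trans (by simp [hammingDist_cons])
    have h2 (a b : α 0) : (g a - g b) ^ 2 ≤ B ^ 2 := by
      rw [← sq_abs]
      gcongr
      rw [← Finset.sum_sub_distrib]
      refine (Finset.abs_sum_le_sum_abs _ _).trans ?_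
      refine (Finset.sum_le_card_nsmul _ _ 1 fun x _ => ?_).trans (by simp [B])
      refine (hf _ _).trans ?_
      rw [hammingDist_cons, hammingDist_self]
      split_ifs <;> simp
    calc _ ≤ A * ∑ a : α 0, n * B ^ 2 + ∑ a : α 0, ∑ b : α 0, B ^ 2 := by
          rw [hsplit]
          refine add_le_add ?_ (Finset.sum_le_sum fun a _ => Finset.sum_le_sum fun b _ => h2 a b)
          exact mul_le_mul_of_nonneg_left (Finset.sum_le_sum fun a _ => h1 a) (Nat.cast_nonneg _)
      _ = _ := by
          simp only [Finset.sum_const, Finset.card_univ, nsmul_eq_mul, hcard]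
          push_cast
          ring

/-- Two sets of density at least `δ` in a product of `n` finite sets have points at Hamming
distance at most `r`, as soon as `r` exceeds `√n / δ`: apply the variance bound to the distance
to the first set. -/
theorem exists_hammingDist_le {n : ℕ} {α : Fin n → Type*} [∀ i, Fintype (α i)]
    [∀ i, DecidableEq (α i)] [∀ i, Nonempty (α i)] {δ r : ℝ} (hδ : 0 < δ) (hr : 0 < r)
    (hn : n < δ ^ 2 * r ^ 2) {A B : Finset (∀ i, α i)}
    (hA : δ * Fintype.card (∀ i, α i) ≤ A.card) (hB : δ * Fintype.card (∀ i, α i) ≤ B.card) :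
    ∃ a ∈ A, ∃ b ∈ B, (hammingDist a b : ℝ) ≤ r := by
  by_contra! hcon
  have hN : (0 : ℝ) < Fintype.card (∀ i, α i) := by exact_mod_cast Fintype.card_pos
  have hA0 : A.Nonempty := by
    rw [← Finset.card_pos]
    exact_mod_cast (mul_pos hδ hN).trans_le hA
  let f : (∀ i, α i) → ℝ := fun x => A.inf' hA0 fun a => (hammingDist x a : ℝ)
  have hle (x y) : f x ≤ hammingDist x y + f y := by
    obtain ⟨a, ha, hfa⟩ := A.exists_mem_eq_inf' hA0 fun a => (hammingDist y a : ℝ)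
    have : f y = hammingDist y a := hfa
    rw [this]
    refine (Finset.inf'_le _ ha).trans ?_
    exact_mod_cast hammingDist_triangle x y a
  have hlip (x y) : |f x - f y| ≤ hammingDist x y := by
    rw [abs_le]
    constructor
    · have := hle y x
      rw [hammingDist_comm] at this
      linarith
    · have := hle x y
      linarith
  have hzero (a) (ha : a ∈ A) : f a ≤ 0 :=
    (Finset.inf'_le _ ha).trans (by simp)
  have hfar (b) (hb : b ∈ B) : r ≤ f b := by
    refine Finset.le_inf' _ _ fun a ha => ?_
    rw [hammingDist_comm]
    exact (hcon a ha b hb).le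
  have hlow : A.card * (B.card * r ^ 2) ≤ ∑ x, ∑ y, (f x - f y) ^ 2 := by
    calc _ = ∑ x ∈ A, ∑ y ∈ B, r ^ 2 := by simp
      _ ≤ ∑ x ∈ A, ∑ y ∈ B, (f x - f y) ^ 2 := by
          refine Finset.sum_le_sum fun x hx => Finset.sum_le_sum fun y hy => ?_
          nlinarith [hzero x hx, hfar y hy]
      _ ≤ ∑ x ∈ A, ∑ y, (f x - f y) ^ 2 := by
          refine Finset.sum_le_sum fun x _ => ?_
          exact Finset.sum_le_sum_of_subset_of_nonneg (Finset.subset_univ _)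
            fun _ _ _ => sq_nonneg _
      _ ≤ _ := Finset.sum_le_sum_of_subset_of_nonneg (Finset.subset_univ _)
          fun _ _ _ => Finset.sum_nonneg fun _ _ => sq_nonneg _
  have hup := sum_sum_sub_sq_le_of_hammingDist hlip
  set N : ℝ := (Fintype.card (∀ i, α i) : ℝ)
  have h3 : (δ * N) * ((δ * N) * r ^ 2) ≤ A.card * (B.card * r ^ 2) := by gcongr
  have h4 : n * N ^ 2 < δ ^ 2 * r ^ 2 * N ^ 2 := by gcongr
  nlinarith

/-- Among any `δ`-dense set of residues modulo a product of pairwise coprime moduli there are two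
whose difference has the prescribed residues for all but at most `r` of the moduli. -/
theorem exists_card_residue_ne_le {n : ℕ} {q : Fin n → ℕ} (hq : ∀ i, 0 < q i)
    (hco : Pairwise (Function.onFun Nat.Coprime q)) {δ r : ℝ} (hδ : 0 < δ) (hr : 0 < r)
    (hn : n < δ ^ 2 * r ^ 2) (c : ∀ i, ZMod (q i)) {A : Finset ℕ}
    (hAQ : A ⊆ Finset.range (∏ i, q i)) (hA : δ * (∏ i, q i : ℕ) ≤ A.card) :
    ∃ a ∈ A, ∃ b ∈ A,
      ((Finset.univ.filter fun i => ((a - b : ℤ) : ZMod (q i)) ≠ c i).card : ℝ) ≤ r := by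
  have (i : Fin n) : NeZero (q i) := ⟨(hq i).ne'⟩
  have : NeZero (∏ i, q i) := ⟨(Finset.prod_pos fun i _ => hq i).ne'⟩
  let e := ZMod.prodEquivPi q hco
  let φ : ℕ → ∀ i, ZMod (q i) := fun a i => a
  have hφe (a : ℕ) : φ a = e a := by
    rw [map_natCast]; rfl
  have hinj : Set.InjOn φ A := by
    intro a ha b hb hab
    rw [hφe, hφe, e.injective.eq_iff, ZMod.natCast_eq_natCast_iff] at hab
    exact hab.eq_of_lt_of_lt (Finset.mem_range.1 (hAQ ha)) (Finset.mem_range.1 (hAQ hb))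
  have hcard : Fintype.card (∀ i, ZMod (q i)) = ∏ i, q i := by simp [ZMod.card]
  obtain ⟨x, hx, y, hy, hxy⟩ := exists_hammingDist_le hδ hr hn
    (A := A.image φ) (B := (A.image φ).image fun x => x + c)
    (by rwa [hcard, Finset.card_image_of_injOn hinj])
    (by rwa [hcard, Finset.card_image_of_injective _ (add_left_injective c),
      Finset.card_image_of_injOn hinj])
  obtain ⟨a, ha, rfl⟩ := Finset.mem_image.1 hx
  obtain ⟨_, hz, rfl⟩ := Finset.mem_image.1 hy
  obtain ⟨b, hb, rfl⟩ := Finset.mem_image.1 hz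
  refine ⟨a, ha, b, hb, hxy.trans' ?_⟩
  refine le_of_eq ?_
  congr 2
  ext i
  simp [φ, sub_eq_iff_eq_add']

/-! ### Characters at points of coprime prime denominators -/

theorem fourier_coe_eq_fourier_one (n : ℤ) (x : ℝ) :
    fourier n (x : UnitAddCircle) = fourier 1 ((n * x : ℝ) : UnitAddCircle) := by
  rw [fourier_coe_apply, fourier_coe_apply]
  congr 1
  push_cast
  ring

theorem norm_fourier_coe_sub_le (n : ℤ) (x y : ℝ) :
    ‖(fourier n (x : UnitAddCircle) : ℂ) - fourier n (y : UnitAddCircle)‖ ≤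
      2 * Real.pi * |(n : ℝ)| * |x - y| := by
  have h1 : (fourier n (x : UnitAddCircle) : ℂ) - fourier n (y : UnitAddCircle) =
      fourier n (y : UnitAddCircle) *
        (Complex.exp (Complex.I * ((2 * Real.pi * n * (x - y) : ℝ) : ℂ)) - 1) := by
    rw [fourier_coe_apply, fourier_coe_apply, mul_sub, ← Complex.exp_add, mul_one]
    congr 2
    push_cast
    ring
  rw [h1, norm_mul, fourier_apply, Circle.norm_coe, one_mul]
  refine (Real.norm_exp_I_mul_ofReal_sub_one_le).trans ?_
  rw [Real.norm_eq_abs, abs_mul, abs_mul, abs_of_pos Real.two_pi_pos]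

/-- The values of the characters at a point `a / q` of prime denominator are all the `q`-th roots
of unity, so a suitable residue class of frequencies approximates a prescribed value. -/
theorem exists_residue_norm_fourier_sub_lt {q : ℕ} (hq : q.Prime) {a : ℤ} (ha : ¬ (q : ℤ) ∣ a)
    {ε : ℝ} (hε : 2 * Real.pi < ε * q) {z : ℂ} (hz : ‖z‖ = 1) :
    ∃ c : ZMod q, ∀ s : ℤ, (s : ZMod q) = c →
      ‖(fourier s ((a / q : ℝ) : UnitAddCircle) : ℂ) - z‖ < ε := by
  have : Fact q.Prime := ⟨hq⟩
  have hq0 : (0 : ℝ) < q := by exact_mod_cast hq.pos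
  obtain ⟨t, rfl⟩ : ∃ t : ℝ, z = fourier 1 (t : UnitAddCircle) := by
    obtain ⟨t, ht⟩ := (Complex.norm_eq_one_iff z).1 hz
    refine ⟨t / (2 * Real.pi), ?_⟩
    rw [fourier_coe_apply, ← ht]
    congr 1
    have := Real.pi_ne_zero
    push_cast
    field_simp
  let b : ℤ := ⌊t * q⌋
  have ha' : (a : ZMod q) ≠ 0 := by rwa [Ne, ZMod.intCast_zmod_eq_zero_iff_dvd]
  refine ⟨b * (a : ZMod q)⁻¹, fun s hs => ?_⟩
  have hsa : ((s * a - b : ℤ) : ZMod q) = 0 := by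
    push_cast
    rw [hs, inv_mul_cancel_right₀ ha', sub_self]
  obtain ⟨l, hl⟩ := (ZMod.intCast_zmod_eq_zero_iff_dvd _ q).1 hsa
  have hpt : ((s * (a / q : ℝ) : ℝ) : UnitAddCircle) = ((b / q : ℝ) : UnitAddCircle) := by
    have : (s * (a / q : ℝ) : ℝ) = b / q + l • (1 : ℝ) := by
      have : (s * a - b : ℝ) = q * l := by exact_mod_cast hl
      field_simp
      simp only [zsmul_eq_mul, mul_one]
      linarith
    rw [this]
    simp
  rw [fourier_coe_eq_fourier_one, hpt]
  refine (norm_fourier_coe_sub_le 1 _ _).trans_lt ?_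
  have h1 : |(b / q : ℝ) - t| ≤ 1 / q := by
    have h2 := Int.floor_le (t * q)
    have h3 := Int.lt_floor_add_one (t * q)
    have : (b / q : ℝ) - t = (b - t * q) / q := by field_simp
    rw [this, abs_div, abs_of_pos hq0]
    gcongr
    rw [abs_le]
    constructor <;> linarith
  calc _ ≤ 2 * Real.pi * |((1 : ℤ) : ℝ)| * (1 / q) := by gcongr
    _ < ε := by
      simp only [Int.cast_one, abs_one, mul_one, mul_one_div]
      rwa [div_lt_iff₀ hq0]

theorem exists_int_not_dvd_abs_div_sub_le {q : ℕ} (hq : q.Prime) (y : ℝ) :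
    ∃ a : ℤ, ¬ (q : ℤ) ∣ a ∧ |(a / q : ℝ) - y| ≤ 1 / q := by
  have hq0 : (0 : ℝ) < q := by exact_mod_cast hq.pos
  have h2 := Int.floor_le (y * q)
  have h3 := Int.lt_floor_add_one (y * q)
  have key (a : ℤ) (h : |(a : ℝ) - y * q| ≤ 1) : |(a / q : ℝ) - y| ≤ 1 / q := by
    have : (a / q : ℝ) - y = (a - y * q) / q := by field_simp
    rw [this, abs_div, abs_of_pos hq0]
    gcongr
  by_cases h : (q : ℤ) ∣ ⌊y * q⌋
  · refine ⟨⌊y * q⌋ + 1, fun h' => ?_, key _ ?_⟩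
    · have h1 := (Int.dvd_add_right h).1 h'
      exact hq.one_lt.ne' (by exact_mod_cast Int.eq_one_of_dvd_one (by positivity) h1)
    · push_cast
      rw [abs_le]
      constructor <;> linarith
  · refine ⟨_, h, key _ ?_⟩
    rw [abs_le]
    constructor <;> linarith

theorem IsMeasureExpanding.image_add {S : Set ℤ} (hS : IsMeasureExpanding S) (m : ℤ) :
    IsMeasureExpanding ((fun s : ℤ => s + m) '' S) := by
  intro k
  have := hS (m + k)
  rwa [Set.image_image, show (fun s : ℤ => s + m + k) = fun s => s + (m + k) by
    funext s; ring]

/-- If `n` is large in terms of `δ` and `ε`, any `n` points can be moved slightly so that, along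
finitely many elements of each translate `S + m` with `|m| ≤ M`, the characters at the new points
come `ε`-close to arbitrary unimodular values `z`, with at most `ε n` exceptions, while recurring
at density `δ`.  The new points are fractions with distinct large prime denominators, so that the
Chinese remainder theorem turns the condition on the frequency into a Hamming ball of residues. -/
theorem IsMeasureExpanding.exists_perturbation {S : Set ℤ} (hS : IsMeasureExpanding S) {n : ℕ}
    {δ ε : ℝ} (hδ : 0 < δ) (hε : 0 < ε) (hn : n < (δ / 2) ^ 2 * (ε * n) ^ 2) (y : Fin n → ℝ)
    {η : ℝ} (hη : 0 < η) (M : ℕ) :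
    ∃ P : Fin n → ℝ, (∀ j, |P j - y j| < η) ∧ ∃ W : Finset ℤ, ∀ m : ℤ, |m| ≤ M →
      ∀ z : Fin n → ℂ, (∀ j, ‖z j‖ = 1) →
        IsRecurrentAt δ {s | s ∈ W ∧ s - m ∈ S ∧ ((Finset.univ.filter fun j =>
          ε ≤ ‖(fourier s (P j : UnitAddCircle) : ℂ) - z j‖).card : ℝ) ≤ ε * n} := by
  classical
  have hn0 : n ≠ 0 := by
    rintro rfl
    simp at hn
  have hεn : 0 < ε * n := by positivity
  obtain ⟨B, hB⟩ := exists_nat_gt (max (1 / η) (2 * Real.pi / ε))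
  let q : Fin n → ℕ := fun j => Nat.nth Nat.Prime (B + j)
  have hqp (j) : (q j).Prime := Nat.prime_nth_prime _
  have hqB (j) : (B : ℝ) < q j := by
    have := Nat.add_two_le_nth_prime (B + j)
    have : B < q j := by simp only [q]; omega
    exact_mod_cast this
  have hq0 (j) : (0 : ℝ) < q j := (Nat.cast_nonneg B).trans_lt (hqB j)
  have hco : Pairwise (Function.onFun Nat.Coprime q) := by
    intro i j hij
    refine (Nat.coprime_primes (hqp i) (hqp j)).2 fun h => hij ?_
    have := Nat.nth_injective Nat.infinite_setOfPred_prime h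
    exact Fin.ext (by omega)
  have (j : Fin n) : NeZero (q j) := ⟨(hqp j).ne_zero⟩
  choose a ha hay using fun j => exists_int_not_dvd_abs_div_sub_le (hqp j) (y j)
  -- Prescribing residues `c` in place of values `z` leaves finitely many sets to treat.
  let R (m : ℤ) (c : ∀ j, ZMod (q j)) : Set ℤ :=
    {s | s - m ∈ S ∧ ((Finset.univ.filter fun j => (s : ZMod (q j)) ≠ c j).card : ℝ) ≤ ε * n}
  have hR (m : ℤ) (c : ∀ j, ZMod (q j)) : IsRecurrentAt δ (R m c) := by
    refine ((hS.image_add m).isRecurrentAt_modEq hδ (Q := ∏ j, q j)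
      (Finset.prod_pos fun j _ => (hqp j).pos)
      (K := {k | ((Finset.univ.filter fun j => (k : ZMod (q j)) ≠ c j).card : ℝ) ≤ ε * n})
      ?_).mono le_rfl ?_
    · intro A hAQ hA
      exact exists_card_residue_ne_le (fun j => (hqp j).pos) hco (half_pos hδ) hεn hn c hAQ hA
    · rintro _ ⟨⟨s, hs, rfl⟩, k, hk, hsk⟩
      refine ⟨by simpa using hs, ?_⟩
      have (j : Fin n) : ((s + m : ℤ) : ZMod (q j)) = k := by
        rw [ZMod.intCast_eq_intCast_iff]
        exact hsk.of_dvd (by exact_mod_cast Finset.dvd_prod_of_mem q (Finset.mem_univ j))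
      simpa only [this, Set.mem_ofPred_eq] using hk
  choose W hWR hW using fun m c => (hR m c).exists_finset
  refine ⟨fun j => a j / q j, fun j => (hay j).trans_lt ?_,
    (Finset.Icc (-(M : ℤ)) M).biUnion fun m => Finset.univ.biUnion fun c => W m c, ?_⟩
  · rw [one_div_lt (hq0 j) hη]
    exact ((le_max_left _ _).trans_lt hB).trans (hqB j)
  · intro m hm z hz
    have hε' (j) : 2 * Real.pi < ε * q j := by
      rw [← div_lt_iff₀' hε]
      exact ((le_max_right _ _).trans_lt hB).trans (hqB j)
    choose c hc using fun j => exists_residue_norm_fourier_sub_lt (hqp j) (ha j) (hε' j) (hz j)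
    refine (hW m c).mono le_rfl fun s hs => ⟨?_, (hWR m c hs).1, ?_⟩
    · simp only [Finset.mem_biUnion, Finset.mem_Icc, Finset.mem_univ, true_and]
      exact ⟨m, abs_le.1 hm, c, hs⟩
    · refine le_trans ?_ (hWR m c hs).2
      exact_mod_cast Finset.card_le_card (Finset.monotone_filter_right _ fun j _ hj h =>
        absurd (hc j s h) (not_lt.2 hj))

/-! ### The limit of the perturbed points -/

/-- One stage of the construction, for `16 ^ k` points and tolerance `2 / 2 ^ k`, both for the
recurrence density and for the approximation.  The number `16 ^ k` is large enough for the
concentration estimate at this tolerance.  By the bound on `η'`, the characters with frequency in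
`W` change by at most the tolerance when points move by at most `2 η'`. -/
theorem IsMeasureExpanding.exists_stage {S : Set ℤ} (hS : IsMeasureExpanding S) (k : ℕ)
    (y : ℕ → ℝ) {η : ℝ} (hη : 0 < η) :
    ∃ (P : ℕ → ℝ) (W : Finset ℤ) (η' : ℝ), (∀ j, |P j - y j| < η) ∧ 0 < η' ∧ η' ≤ η / 2 ∧
      (∀ n ∈ W, 2 * Real.pi * |(n : ℝ)| * (2 * η') ≤ 2 / 2 ^ k) ∧
      ∀ m : ℤ, |m| ≤ k → ∀ z : ℕ → ℂ, (∀ j, ‖z j‖ = 1) →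
        IsRecurrentAt (2 / 2 ^ k) {s | s ∈ W ∧ s - m ∈ S ∧
          (((Finset.range (16 ^ k)).filter fun j =>
            2 / 2 ^ k ≤ ‖(fourier s (P j : UnitAddCircle) : ℂ) - z j‖).card : ℝ) ≤
              2 / 2 ^ k * 16 ^ k} := by
  have hε : (0 : ℝ) < 2 / 2 ^ k := by positivity
  obtain ⟨P, hP, W, hW⟩ := hS.exists_perturbation (n := 16 ^ k) hε hε (by
      have h16 : (16 : ℝ) ^ k = 2 ^ k * 2 ^ k * 2 ^ k * 2 ^ k := by
        rw [← mul_pow, ← mul_pow, ← mul_pow]; norm_num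
      have h2 : (0 : ℝ) < 2 ^ k := by positivity
      push_cast
      rw [h16]
      field_simp
      nlinarith) (fun j => y j) hη k
  obtain ⟨η', hη', hη'η, hη'W⟩ : ∃ η' : ℝ, 0 < η' ∧ η' ≤ η / 2 ∧
      ∀ n ∈ W, 2 * Real.pi * |(n : ℝ)| * (2 * η') ≤ 2 / 2 ^ k := by
    have hC : 0 ≤ ∑ n ∈ W, 2 * Real.pi * |(n : ℝ)| := by positivity
    refine ⟨min (η / 2) (2 / 2 ^ k / (2 * (1 + ∑ n ∈ W, 2 * Real.pi * |(n : ℝ)|))),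
      by positivity, min_le_left _ _, fun n hn => ?_⟩
    have hn' : 2 * Real.pi * |(n : ℝ)| ≤ ∑ n ∈ W, 2 * Real.pi * |(n : ℝ)| :=
      Finset.single_le_sum (f := fun n : ℤ => 2 * Real.pi * |(n : ℝ)|)
        (fun _ _ => by positivity) hn
    set C := ∑ n ∈ W, 2 * Real.pi * |(n : ℝ)|
    calc _ ≤ (1 + C) * (2 * (2 / 2 ^ k / (2 * (1 + C)))) := by
          gcongr
          · linarith
          · exact min_le_right _ _
      _ = _ := by field_simp
  -- Points with index at least `16 ^ k` play no role and are left where they are.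
  refine ⟨fun j => if h : j < 16 ^ k then P ⟨j, h⟩ else y j, W, η', fun j => ?_, hη', hη'η,
    hη'W, fun m hm z hz => ?_⟩
  · by_cases h : j < 16 ^ k
    · simpa [h] using hP ⟨j, h⟩
    · simpa [h] using hη
  · refine (hW m hm (fun j => z j) fun j => hz j).mono le_rfl ?_
    rintro s ⟨h1, h2, h3⟩
    refine ⟨h1, h2, ?_⟩
    rw [Nat.cast_pow, Nat.cast_ofNat] at h3
    refine le_trans (le_of_eq ?_) h3
    rw [Finset.card_filter, Finset.card_filter, Finset.sum_range]
    simp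

/-- A limit `Φ` of step functions `P k` at scale `16 ^ (-k)`, close to `P k` as seen by the
characters with frequency in a finite set `W k`.  These frequencies include enough elements of every
translate `S + m` with `|m| ≤ k` to approximate any unimodular step function `z` at that scale by
characters of `P k`, while recurring at density `2 / 2 ^ k`. -/
theorem IsMeasureExpanding.exists_limit {S : Set ℤ} (hS : IsMeasureExpanding S) :
    ∃ (Φ : ℝ → ℝ) (P : ℕ → ℕ → ℝ) (W : ℕ → Finset ℤ), Measurable Φ ∧
      (∀ k ω, ∀ n ∈ W k, ‖(fourier n (Φ ω : UnitAddCircle) : ℂ) -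
        fourier n (P k ⌊(16 : ℝ) ^ k * ω⌋₊ : UnitAddCircle)‖ ≤ 2 / 2 ^ k) ∧
      ∀ (k : ℕ) (m : ℤ), |m| ≤ k → ∀ z : ℕ → ℂ, (∀ j, ‖z j‖ = 1) →
        IsRecurrentAt (2 / 2 ^ k) {s | s ∈ W k ∧ s - m ∈ S ∧
          (((Finset.range (16 ^ k)).filter fun j =>
            2 / 2 ^ k ≤ ‖(fourier s (P k j : UnitAddCircle) : ℂ) - z j‖).card : ℝ) ≤
              2 / 2 ^ k * 16 ^ k} := by
  choose P W η hP hpos hhalf hW hrec using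
    fun (k : ℕ) (d : (ℕ → ℝ) × {η : ℝ // 0 < η}) =>
      hS.exists_stage k (fun j => d.1 (j / 16)) d.2.2
  let st : ℕ → (ℕ → ℝ) × {η : ℝ // 0 < η} := fun k =>
    Nat.rec (0, ⟨1, one_pos⟩) (fun k d => (P k d, ⟨η k d, hpos k d⟩)) k
  let a : ℕ → ℝ → ℝ := fun k ω => P k (st k) ⌊(16 : ℝ) ^ k * ω⌋₊
  have hηle (k i : ℕ) : η (k + i) (st (k + i)) ≤ η k (st k) / 2 ^ i := by
    induction i with
    | zero => simp
    | succ i ih =>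
      refine (hhalf (k + i + 1) (st (k + i + 1))).trans ?_
      rw [pow_succ, ← div_div]
      exact div_le_div_of_nonneg_right ih zero_le_two
  have hstep (k : ℕ) (ω : ℝ) : dist (a k ω) (a (k + 1) ω) ≤ η k (st k) := by
    rw [dist_comm, Real.dist_eq]
    have hfl : ⌊(16 : ℝ) ^ k * ω⌋₊ = ⌊(16 : ℝ) ^ (k + 1) * ω⌋₊ / 16 := by
      rw [← Nat.floor_div_ofNat]
      congr 1
      rw [pow_succ]
      ring
    have h := hP (k + 1) (st (k + 1)) ⌊(16 : ℝ) ^ (k + 1) * ω⌋₊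
    rw [← hfl] at h
    exact h.le
  -- All moves after stage `k` add up to at most `2 * η k`.
  have hdist (k i : ℕ) (ω : ℝ) :
      dist (a (k + i) ω) (a (k + (i + 1)) ω) ≤ 2 * η k (st k) / 2 / 2 ^ i := by
    rw [mul_div_cancel_left₀ _ two_ne_zero]
    exact (hstep (k + i) ω).trans (hηle k i)
  have hlim (ω : ℝ) : ∃ L, Filter.Tendsto (fun k => a k ω) Filter.atTop (nhds L) := by
    refine cauchySeq_tendsto_of_complete (cauchySeq_of_le_geometric_two (C := 2 * η 0 (st 0)) ?_)
    intro i
    simpa using hdist 0 i ω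
  choose Φ hΦ using hlim
  refine ⟨Φ, fun k => P k (st k), fun k => W k (st k), ?_, ?_, fun k => hrec k (st k)⟩
  · refine measurable_of_tendsto_metrizable (fun k => ?_) (tendsto_pi_nhds.2 hΦ)
    exact (measurable_from_nat (f := P k (st k))).comp
      (Nat.measurable_floor.comp (measurable_const_mul _))
  · intro k ω n hn
    refine (norm_fourier_coe_sub_le n _ _).trans (le_trans ?_ (hW k (st k) n hn))
    gcongr
    rw [← Real.dist_eq, dist_comm]
    refine dist_le_of_le_geometric_two_of_tendsto₀ (f := fun i => a (k + i) ω)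
      (fun i => hdist k i ω) ?_
    simpa only [add_comm k] using (Filter.tendsto_add_atTop_iff_nat k).2 (hΦ ω)

/-! ### Approximation by step functions on `[0, 1)` -/

theorem volume_restrict_floor_mem_le {N : ℕ} (hN : 0 < N) (B : Finset ℕ) :
    (volume.restrict (Set.Ico (0 : ℝ) 1)) {ω | ⌊(N : ℝ) * ω⌋₊ ∈ B} ≤
      ENNReal.ofReal (B.card / N) := by
  have hN' : (0 : ℝ) < N := by exact_mod_cast hN
  have hm : MeasurableSet {ω : ℝ | ⌊(N : ℝ) * ω⌋₊ ∈ B} :=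
    (Nat.measurable_floor.comp (measurable_const_mul _)) B.measurableSet
  rw [Measure.restrict_apply hm]
  calc _ ≤ volume (⋃ j ∈ B, Set.Ico (j / N : ℝ) ((j + 1) / N)) := by
        refine measure_mono ?_
        rintro ω ⟨hω, h0, -⟩
        refine Set.mem_biUnion hω ⟨?_, ?_⟩
        · rw [div_le_iff₀' hN']
          exact Nat.floor_le (by positivity)
        · rw [lt_div_iff₀' hN']
          exact Nat.lt_floor_add_one _
    _ ≤ ∑ j ∈ B, volume (Set.Ico (j / N : ℝ) ((j + 1) / N)) := measure_biUnion_finset_le _ _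
    _ = _ := by
        simp only [Real.volume_Ico, ← sub_div, add_sub_cancel_left, Finset.sum_const, nsmul_eq_mul]
        rw [← ENNReal.ofReal_natCast, ← ENNReal.ofReal_mul (Nat.cast_nonneg _), mul_one_div]

/-- Projecting to the unit circle at most doubles the distance to a unimodular number. -/
theorem exists_norm_eq_one_forall_norm_sub_le (c : ℂ) :
    ∃ u : ℂ, ‖u‖ = 1 ∧ ∀ v : ℂ, ‖v‖ = 1 → ‖v - u‖ ≤ 2 * ‖v - c‖ := by
  by_cases hc : c = 0
  · refine ⟨1, norm_one, fun v hv => (norm_sub_le _ _).trans ?_⟩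
    rw [hc, sub_zero, hv, norm_one]
    norm_num
  · have hc' : (‖c‖ : ℂ) ≠ 0 := by simpa using hc
    refine ⟨c / ‖c‖, by simp [hc], fun v hv => ?_⟩
    have h1 : ‖c - c / ‖c‖‖ ≤ ‖v - c‖ := by
      have : c - c / ‖c‖ = c / ‖c‖ * ((‖c‖ - 1 : ℝ) : ℂ) := by
        push_cast
        field_simp
      rw [this, norm_mul, Complex.norm_real, norm_div, Complex.norm_real, norm_norm,
        div_self (by simpa using hc), one_mul, ← hv, norm_sub_rev v]
      exact abs_norm_sub_norm_le c v
    calc ‖v - c / ‖c‖‖ ≤ ‖v - c‖ + ‖c - c / ‖c‖‖ := norm_sub_le_norm_sub_add_norm_sub _ _ _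
      _ ≤ _ := by linarith

/-- A unimodular measurable function is an `L¹` limit of unimodular step functions. -/
theorem exists_step_approx {F : ℝ → ℂ} (hF : Measurable F) (hF1 : ∀ ω, ‖F ω‖ = 1) {ε : ℝ}
    (hε : 0 < ε) : ∃ N₀ : ℕ, ∀ N : ℕ, N₀ ≤ N → ∃ z : ℕ → ℂ, (∀ j, ‖z j‖ = 1) ∧
      ∫⁻ ω in Set.Ico (0 : ℝ) 1, ‖F ω - z ⌊(N : ℝ) * ω⌋₊‖ₑ ≤ ENNReal.ofReal ε := by
  have hint : Integrable F (volume.restrict (Set.Ico (0 : ℝ) 1)) :=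
    Integrable.of_bound hF.aestronglyMeasurable 1 (Filter.Eventually.of_forall fun ω => (hF1 ω).le)
  obtain ⟨g, hgs, hFg, hgc, -⟩ := hint.exists_hasCompactSupport_lintegral_sub_le
    (ε := ENNReal.ofReal (ε / 4)) (by simpa using hε)
  obtain ⟨d, hd, hgd⟩ := Metric.uniformContinuous_iff.1
    (hgs.uniformContinuous_of_continuous hgc) (ε / 4) (by positivity)
  obtain ⟨N₀, hN₀⟩ := exists_nat_gt (1 / d)
  refine ⟨N₀, fun N hN => ?_⟩
  have hNd : 1 / d < N := hN₀.trans_le (by exact_mod_cast hN)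
  have hN0 : (0 : ℝ) < N := (by positivity : 0 < 1 / d).trans hNd
  choose u hu1 hu using exists_norm_eq_one_forall_norm_sub_le
  refine ⟨fun j => u (g (j / N)), fun j => hu1 _, ?_⟩
  have hpt : ∀ ω ∈ Set.Ico (0 : ℝ) 1, ‖F ω - u (g (⌊(N : ℝ) * ω⌋₊ / N))‖ₑ ≤
      2 * ‖F ω - g ω‖ₑ + ENNReal.ofReal (ε / 2) := by
    rintro ω ⟨h0, -⟩
    have hdist : dist ω (⌊(N : ℝ) * ω⌋₊ / N) < d := by
      have h2 := Nat.floor_le (show 0 ≤ (N : ℝ) * ω by positivity)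
      have h3 := Nat.lt_floor_add_one ((N : ℝ) * ω)
      have : ω - ⌊(N : ℝ) * ω⌋₊ / N = (N * ω - ⌊(N : ℝ) * ω⌋₊) / N := by field_simp
      rw [Real.dist_eq, this, abs_div, abs_of_pos hN0, div_lt_iff₀ hN0]
      rw [div_lt_iff₀' hd] at hNd
      refine lt_of_le_of_lt ?_ hNd
      rw [abs_le]
      constructor <;> linarith
    have h4 := hgd hdist
    rw [dist_eq_norm] at h4
    rw [← ofReal_norm, ← ofReal_norm, ← ENNReal.ofReal_ofNat 2,
      ← ENNReal.ofReal_mul zero_le_two, ← ENNReal.ofReal_add (by positivity) (by positivity)]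
    refine ENNReal.ofReal_le_ofReal ?_
    have h5 := hu (g (⌊(N : ℝ) * ω⌋₊ / N)) (F ω) (hF1 ω)
    have h6 := norm_sub_le_norm_sub_add_norm_sub (F ω) (g ω) (g (⌊(N : ℝ) * ω⌋₊ / N))
    linarith
  calc _ ≤ ∫⁻ ω in Set.Ico (0 : ℝ) 1, (2 * ‖F ω - g ω‖ₑ + ENNReal.ofReal (ε / 2)) :=
        setLIntegral_mono' measurableSet_Ico hpt
    _ = 2 * (∫⁻ ω in Set.Ico (0 : ℝ) 1, ‖F ω - g ω‖ₑ) + ENNReal.ofReal (ε / 2) := by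
        rw [lintegral_add_right _ measurable_const, lintegral_const_mul' _ _ (by simp)]
        simp
    _ ≤ 2 * ENNReal.ofReal (ε / 4) + ENNReal.ofReal (ε / 2) := by gcongr
    _ = ENNReal.ofReal ε := by
        rw [← ENNReal.ofReal_ofNat 2, ← ENNReal.ofReal_mul zero_le_two,
          ← ENNReal.ofReal_add (by positivity) (by positivity)]
        congr 1
        ring

/-! ### The measure -/

/-- A KS measure for a class of sets of recurrence has no atoms: by approximation of the
constant `-1`, an atom `a` would yield a set of recurrence of numbers `n` for which `n • a` stays
away from `0`, contrary to the rotation by `a`. -/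
theorem IsKSMeasure.measure_singleton_eq_zero {S : Set ℤ} {σ : Measure UnitAddCircle}
    (hσ : IsKSMeasure S {A : Set ℤ | IsMeasureExpanding A} σ) (a : UnitAddCircle) :
    σ {a} = 0 := by
  by_contra h0
  have := hσ.isProbabilityMeasure
  have hpos : 0 < (σ {a}).toReal := ENNReal.toReal_pos h0 (measure_ne_top _ _)
  have : IsProbabilityMeasure (volume : Measure UnitAddCircle) := ⟨by simp⟩
  have hA := hσ.mem _ hpos (fun _ => -1) measurable_const (by simp)
  rw [ENNReal.ofReal_toReal (measure_ne_top _ _)] at hA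
  obtain ⟨_, ⟨n, ⟨-, hn⟩, rfl⟩, hrec⟩ := hA 0 UnitAddCircle volume (MeasurableEquiv.addRight a)
    (measurePreserving_add_right volume a)
    {x | ‖(fourier 1 x : ℂ) - 1‖ < 1 / 2} (by
      exact (isOpen_lt (by fun_prop) continuous_const).measurableSet) (by
      refine (isOpen_lt (by fun_prop) continuous_const).measure_pos volume ⟨0, ?_⟩
      simp)
  have hna : ‖-1 - (fourier n a : ℂ)‖ < 1 := by
    by_contra! hge
    refine hn.not_ge ?_
    rw [eLpNorm_one_eq_lintegral_enorm]
    calc σ {a} = ∫⁻ x in {a}, 1 ∂σ := by simp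
      _ ≤ ∫⁻ x in {a}, ‖-1 - (fourier n x : ℂ)‖ₑ ∂σ := by
          refine setLIntegral_mono' (measurableSet_singleton a) ?_
          rintro x rfl
          rw [← ofReal_norm, ENNReal.one_le_ofReal]
          exact hge
      _ ≤ _ := setLIntegral_le_lintegral _ _
  obtain ⟨_, hx, y, hy, rfl⟩ := nonempty_of_measure_ne_zero hrec.ne'
  simp only [add_zero, Set.mem_ofPred_eq] at hx hy
  rw [addRight_zpow] at hx
  have hmul : (fourier 1 (y + n • a) : ℂ) = fourier 1 y * fourier n a := by
    simp [fourier_apply, AddCircle.toCircle_add]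
  rw [hmul] at hx
  have hone : ‖(fourier 1 y : ℂ)‖ = 1 := by rw [fourier_apply, Circle.norm_coe]
  have h1 : ‖(fourier n a : ℂ) - 1‖ < 1 := by
    have : ‖(fourier n a : ℂ) - 1‖ = ‖(fourier 1 y * fourier n a - 1 : ℂ) - (fourier 1 y - 1)‖ := by
      rw [sub_sub_sub_cancel_right, ← mul_sub_one, norm_mul, hone, one_mul]
    rw [this]
    exact (norm_sub_le _ _).trans_lt (by linarith)
  have h2 : ‖(-1 : ℂ) - 1‖ ≤ _ := norm_sub_le_norm_sub_add_norm_sub (-1 : ℂ) (fourier n a : ℂ) 1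
  rw [show ‖(-1 : ℂ) - 1‖ = 2 by norm_num] at h2
  linarith

/-- Every measure expanding set has a KS measure: the distribution on the circle of the limit
point `Φ ω` for `ω` uniform in `[0, 1)`. -/
theorem IsMeasureExpanding.exists_isKSMeasure {S : Set ℤ} (hS : IsMeasureExpanding S) :
    ∃ σ : Measure UnitAddCircle, IsKSMeasure S {A : Set ℤ | IsMeasureExpanding A} σ := by
  obtain ⟨Φ, P, W, hΦ, hclose, hrec⟩ := hS.exists_limit
  have hΦ' : Measurable fun ω => (Φ ω : UnitAddCircle) := AddCircle.measurable_mk'.comp hΦ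
  have hlam : IsProbabilityMeasure (volume.restrict (Set.Ico (0 : ℝ) 1)) := ⟨by simp⟩
  refine ⟨(volume.restrict (Set.Ico (0 : ℝ) 1)).map fun ω => (Φ ω : UnitAddCircle),
    Measure.isProbabilityMeasure_map hΦ'.aemeasurable, fun ε hε f hf hf1 m => ?_⟩
  refine isSetOfRecurrence_of_forall_isRecurrentAt fun δ hδ => ?_
  have hfm (n : ℤ) : Measurable fun x : UnitAddCircle => (fourier n x : ℂ) :=
    (map_continuous (fourier n)).measurable
  have hnorm (n : ℤ) (x : UnitAddCircle) : ‖(fourier n x : ℂ)‖ = 1 := by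
    rw [fourier_apply, Circle.norm_coe]
  -- Translating the set by `m` amounts to multiplying the target function by the `m`-th character.
  let F : ℝ → ℂ := fun ω => f (Φ ω) * fourier m (Φ ω : UnitAddCircle)
  obtain ⟨N₀, hN₀⟩ := exists_step_approx (F := F)
    ((hf.comp hΦ').mul ((hfm m).comp hΦ')) (fun ω => by rw [norm_mul, hf1, hnorm, one_mul])
    (show 0 < ε / 4 by positivity)
  obtain ⟨k, hkN, hkm, hkδ, hkε⟩ : ∃ k : ℕ, N₀ ≤ 16 ^ k ∧ |m| ≤ k ∧ (2 : ℝ) / 2 ^ k ≤ δ ∧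
      (2 : ℝ) / 2 ^ k ≤ ε / 8 := by
    have hlim : Filter.Tendsto (fun k : ℕ => (2 : ℝ) / 2 ^ k) Filter.atTop (nhds 0) := by
      simpa [div_eq_mul_inv] using
        (tendsto_pow_atTop_nhds_zero_of_lt_one (r := (2 : ℝ)⁻¹) (by norm_num)
          (by norm_num)).const_mul 2
    obtain ⟨k, h1, h2, h3, h4⟩ := ((Filter.eventually_ge_atTop N₀).and
      ((Filter.eventually_ge_atTop m.natAbs).and
      ((hlim.eventually_le_const hδ).and
        (hlim.eventually_le_const (show 0 < ε / 8 by positivity))))).exists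
    exact ⟨k, h1.trans (Nat.lt_pow_self (by norm_num)).le, by rw [Int.abs_eq_natAbs]; omega, h3, h4⟩
  obtain ⟨z, hz1, hz⟩ := hN₀ (16 ^ k) hkN
  rw [Nat.cast_pow, Nat.cast_ofNat] at hz
  refine (hrec k m hkm z hz1).mono hkδ ?_
  rintro s ⟨hsW, hsS, hbad⟩
  refine ⟨s - m, ⟨hsS, ?_⟩, sub_add_cancel s m⟩
  set ρ : ℝ := 2 / 2 ^ k
  have hρ : 0 < ρ := by positivity
  set B := (Finset.range (16 ^ k)).filter fun j =>
    ρ ≤ ‖(fourier s (P k j : UnitAddCircle) : ℂ) - z j‖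
  -- Off the set `E` of measure at most `ρ`, the function `F` differs from the `s`-th character at
  -- `Φ ω` by the step approximation error and two errors `ρ`: from the choice of `s` and from
  -- passing to the limit.
  let E : Set ℝ := {ω | ⌊(16 : ℝ) ^ k * ω⌋₊ ∈ B}
  have hE : MeasurableSet E :=
    (Nat.measurable_floor.comp (measurable_const_mul _)) B.measurableSet
  have hEvol : volume.restrict (Set.Ico (0 : ℝ) 1) E ≤ ENNReal.ofReal ρ := by
    have h := volume_restrict_floor_mem_le (N := 16 ^ k) (by positivity) B
    rw [Nat.cast_pow, Nat.cast_ofNat] at h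
    refine h.trans (ENNReal.ofReal_le_ofReal ?_)
    rwa [div_le_iff₀ (by positivity)]
  have hpt : ∀ ω ∈ Set.Ico (0 : ℝ) 1,
      ‖f (Φ ω) - (fourier (s - m) (Φ ω : UnitAddCircle) : ℂ)‖ₑ ≤
        ‖F ω - z ⌊(16 : ℝ) ^ k * ω⌋₊‖ₑ + (ENNReal.ofReal (2 * ρ) + E.indicator (fun _ => 2) ω) := by
    rintro ω ⟨h0, h1⟩
    set j := ⌊(16 : ℝ) ^ k * ω⌋₊
    have hj : j < 16 ^ k := by
      rw [Nat.floor_lt (by positivity)]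
      push_cast
      exact mul_lt_of_lt_one_right (by positivity) h1
    have hleft : ‖f (Φ ω) - (fourier (s - m) (Φ ω : UnitAddCircle) : ℂ)‖ =
        ‖F ω - fourier s (Φ ω : UnitAddCircle)‖ := by
      have : (fourier s (Φ ω : UnitAddCircle) : ℂ) =
          fourier (s - m) (Φ ω : UnitAddCircle) * fourier m (Φ ω : UnitAddCircle) := by
        rw [← fourier_add, sub_add_cancel]
      simp only [F]
      rw [this, ← sub_mul, norm_mul, hnorm, mul_one]
    have h3 : ‖F ω - fourier s (Φ ω : UnitAddCircle)‖ ≤ ‖F ω - z j‖ +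
        ‖(fourier s (P k j : UnitAddCircle) : ℂ) - z j‖ + ρ := by
      have h4 := hclose k ω s hsW
      have h5 := norm_sub_le_norm_sub_add_norm_sub (F ω) (z j) (fourier s (Φ ω : UnitAddCircle))
      have h6 := norm_sub_le_norm_sub_add_norm_sub (z j) (fourier s (P k j : UnitAddCircle))
        (fourier s (Φ ω : UnitAddCircle))
      rw [norm_sub_rev (z j) (fourier s (P k j : UnitAddCircle))] at h6
      rw [norm_sub_rev] at h4
      linarith
    have hE2 : E.indicator (fun _ => (2 : ENNReal)) ω =
        ENNReal.ofReal (E.indicator (fun _ => (2 : ℝ)) ω) := by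
      by_cases hω : ω ∈ E <;> simp [hω]
    have hEnn : 0 ≤ E.indicator (fun _ => (2 : ℝ)) ω :=
      Set.indicator_nonneg (fun _ _ => zero_le_two) _
    have h7 : ‖(fourier s (P k j : UnitAddCircle) : ℂ) - z j‖ ≤
        ρ + E.indicator (fun _ => (2 : ℝ)) ω := by
      by_cases hω : ω ∈ E
      · rw [Set.indicator_of_mem hω]
        refine (norm_sub_le _ _).trans ?_
        rw [hnorm, hz1]
        linarith
      · rw [Set.indicator_of_notMem hω, add_zero]
        by_contra! hlt
        exact hω (Finset.mem_filter.2 ⟨Finset.mem_range.2 hj, hlt.le⟩)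
    rw [← ofReal_norm, ← ofReal_norm, hleft, hE2, ← ENNReal.ofReal_add (by positivity) hEnn,
      ← ENNReal.ofReal_add (by positivity) (by positivity)]
    exact ENNReal.ofReal_le_ofReal (by linarith)
  rw [eLpNorm_one_eq_lintegral_enorm, lintegral_map (by fun_prop) hΦ']
  calc _ ≤ ∫⁻ ω in Set.Ico (0 : ℝ) 1, (‖F ω - z ⌊(16 : ℝ) ^ k * ω⌋₊‖ₑ +
          (ENNReal.ofReal (2 * ρ) + E.indicator (fun _ => 2) ω)) :=
        setLIntegral_mono' measurableSet_Ico hpt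
    _ = (∫⁻ ω in Set.Ico (0 : ℝ) 1, ‖F ω - z ⌊(16 : ℝ) ^ k * ω⌋₊‖ₑ) +
          (ENNReal.ofReal (2 * ρ) + 2 * volume.restrict (Set.Ico (0 : ℝ) 1) E) := by
        have hmeas : Measurable fun ω => ENNReal.ofReal (2 * ρ) + E.indicator (fun _ => 2) ω :=
          (measurable_const.indicator hE).const_add _
        rw [lintegral_add_right _ hmeas,
          lintegral_add_left measurable_const, lintegral_indicator_const hE]
        simp
    _ ≤ ENNReal.ofReal (ε / 4) + (ENNReal.ofReal (2 * ρ) + 2 * ENNReal.ofReal ρ) := by gcongr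
    _ < ENNReal.ofReal ε := by
        rw [← ENNReal.ofReal_ofNat 2, ← ENNReal.ofReal_mul zero_le_two,
          ← ENNReal.ofReal_add (by positivity) (by positivity),
          ← ENNReal.ofReal_add (by positivity) (by positivity)]
        exact (ENNReal.ofReal_lt_ofReal_iff hε).2 (by linarith)

theorem lemma7p4 (S : Set ℤ) (hS : IsMeasureExpanding S) :
    ∃ σ : Measure UnitAddCircle,
      IsKSMeasure S {A : Set ℤ | IsMeasureExpanding A} σ ∧ ∀ a : UnitAddCircle, σ {a} = 0 := by
  obtain ⟨σ, hσ⟩ := hS.exists_isKSMeasure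
  exact ⟨σ, hσ, hσ.measure_singleton_eq_zero⟩
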